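/- Let $H$ be a complex Hilbert space and let $T$ be a (possibly unbounded) self-adjoint operator on $H$ with domain $D(T)$ and spectrum $\sigma(T)\subset\mathbb C$. For an operator $S$ in $H$ let $R(S)$ denote its range; $S$ is called Fredholm if it is closed, $\dim\ker S<\infty$ and $\operatorname{codim}R(S)<\infty$, and its index is then $\dim\ker S-\operatorname{codim}R(S)$. Call $S$ a B-Weyl operator (a B-Fredholm operator of index $0$) if for some integer $n\ge 0$ the range $R(S^n)$ is closed and the restriction $S_n\colon D(S)\cap R(S^n)\to R(S^n)$, $x\mapsto Sx$, is a Fredholm operator of index $0$ in the space $R(S^n)$. Let $$\sigma_{BW}(T)=\{\lambda\in\mathbb C: T-\lambda I\ \text{is not a B-Weyl operator}\},\qquad \sigma_{BD}(T)=\sigma(T)\setminus\sigma_{BW}(T).$$ A Weyl sequence for $T$ at $\lambda$ is a sequence $(u_n)$ in $D(T)$ with $\|u_n\|=1$ for all $n$, $u_n\to 0$ weakly, and $\|(T-\lambda)u_n\|\to 0$. Let $\operatorname{acc}\sigma(T)$ and $\operatorname{iso}\sigma(T)$ be the sets of accumulation points and of isolated points of $\sigma(T)$. Then: 1. A real number $\lambda$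 belongs to $\sigma_{BW}(T)$ if and only if there exists a Weyl sequence for $T$ at $\lambda$ and $\lambda$ is an accumulation point of $\sigma(T)$. 2. $\sigma_{BD}(T)=\operatorname{iso}\sigma(T)$, $\sigma_{BW}(T)=\operatorname{acc}\sigma(T)$, and $$\sigma(T)=\sigma_{BW}(T)\sqcup\sigma_{BD}(T)=\operatorname{acc}\sigma(T)\sqcup\operatorname{iso}\sigma(T),$$ where both unions are disjoint. -/

import Mathlib

open Filter Topology

noncomputable section

namespace UnbddOp

section Algebra

variable {E : Type*} [AddCommGroup E] [Module ℂ E]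

/-- The operator `T - c I`, with the same domain as `T`. -/
def shift (T : E →ₗ.[ℂ] E) (c : ℂ) : E →ₗ.[ℂ] E where
  domain := T.domain
  toFun := T.toFun - c • T.domain.subtype

/-- The range of an operator. -/
def ran (T : E →ₗ.[ℂ] E) : Submodule ℂ E := LinearMap.range T.toFun

/-- The composition `S ∘ T` of (partially defined) operators on its natural domain
`{x ∈ D(T) : T x ∈ D(S)}`. -/
def comp (S T : E →ₗ.[ℂ] E) : E →ₗ.[ℂ] E where
  domain := (S.domain.comap T.toFun).map T.domain.subtype
  toFun :=
    { toFun := fun x => S ⟨T ⟨x, by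
          obtain ⟨y, -, hy⟩ := x.2
          rw [← hy]
          exact y.2⟩, by
        obtain ⟨x, y, hy, rfl⟩ := x
        exact hy⟩
      map_add' := fun x y => by
        rw [← S.map_add]
        congr 1
        ext1
        exact T.map_add ⟨x, _⟩ ⟨y, _⟩
      map_smul' := fun c x => by
        rw [RingHom.id_apply, ← S.map_smul]
        congr 1
        ext1
        exact T.map_smul c ⟨x, _⟩ }

theorem mem_comp_domain (S T : E →ₗ.[ℂ] E) (x : E) :
    x ∈ (comp S T).domain ↔ ∃ h : x ∈ T.domain, T ⟨x, h⟩ ∈ S.domain := by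
  constructor
  · rintro ⟨y, hy, rfl⟩
    exact ⟨y.2, hy⟩
  · rintro ⟨h, hx⟩
    exact ⟨⟨x, h⟩, hx, rfl⟩

/-- The iterates of an operator: `T⁰ = I` (everywhere defined) and `Tⁿ⁺¹ = T ∘ Tⁿ` on its natural
domain. -/
def iter (T : E →ₗ.[ℂ] E) : ℕ → (E →ₗ.[ℂ] E)
  | 0 => LinearMap.id.toPMap ⊤
  | n + 1 => comp T (iter T n)

theorem ran_iter_zero (T : E →ₗ.[ℂ] E) : ran (iter T 0) = ⊤ := by
  rw [eq_top_iff]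
  intro x _
  exact ⟨⟨x, Submodule.mem_top⟩, rfl⟩

theorem mem_ran_iter_succ (T : E →ₗ.[ℂ] E) (n : ℕ) (y : E) :
    y ∈ ran (iter T (n + 1)) ↔ ∃ x : T.domain, (x : E) ∈ ran (iter T n) ∧ T x = y := by
  constructor
  · rintro ⟨z, rfl⟩
    obtain ⟨h, hz⟩ := (mem_comp_domain T (iter T n) z).1 z.2
    exact ⟨⟨iter T n ⟨z, h⟩, hz⟩, ⟨⟨z, h⟩, rfl⟩, rfl⟩
  · rintro ⟨⟨x, hx⟩, ⟨z, hz⟩, rfl⟩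
    have hz' : iter T n z = x := hz
    subst hz'
    exact ⟨⟨z, (mem_comp_domain T (iter T n) z).2 ⟨z.2, hx⟩⟩, rfl⟩

theorem ran_iter_succ_le (T : E →ₗ.[ℂ] E) (n : ℕ) : ran (iter T (n + 1)) ≤ ran (iter T n) := by
  induction n with
  | zero => rw [ran_iter_zero]; exact le_top
  | succ n ih =>
    intro y hy
    obtain ⟨x, hx, rfl⟩ := (mem_ran_iter_succ T (n + 1) y).1 hy
    exact (mem_ran_iter_succ T n _).2 ⟨x, ih hx, rfl⟩

/-- The restriction `Tₙ : D(T) ∩ R(Tⁿ) → R(Tⁿ)`, `x ↦ T x`, an operator in the space `R(Tⁿ)`. -/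
def restrictRan (T : E →ₗ.[ℂ] E) (n : ℕ) : ran (iter T n) →ₗ.[ℂ] ran (iter T n) where
  domain := T.domain.comap (ran (iter T n)).subtype
  toFun :=
    { toFun := fun x => ⟨T ⟨(x : ran (iter T n)), x.2⟩, ran_iter_succ_le T n
        ((mem_ran_iter_succ T n _).2 ⟨⟨(x : ran (iter T n)), x.2⟩, x.1.2, rfl⟩)⟩
      map_add' := fun x y => by
        ext1
        exact T.map_add ⟨(x : ran (iter T n)), x.2⟩ ⟨(y : ran (iter T n)), y.2⟩
      map_smul' := fun c x => by
        ext1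
        exact T.map_smul c ⟨(x : ran (iter T n)), x.2⟩ }

/-- The index `n(T) - d(T) = dim N(T) - codim R(T)`. It is only used for operators of which both
numbers are finite. -/
def index (T : E →ₗ.[ℂ] E) : ℤ :=
  (Module.finrank ℂ (LinearMap.ker T.toFun) : ℤ) - (Module.finrank ℂ (E ⧸ ran T) : ℤ)

end Algebra

section Normed

variable {E : Type*} [NormedAddCommGroup E] [NormedSpace ℂ E]

/-- A Fredholm operator: a closed operator with finite-dimensional null space and range of finite
codimension. -/
structure IsFredholm (T : E →ₗ.[ℂ] E) : Prop where
  isClosed : T.IsClosed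
  finite_ker : Module.Finite ℂ (LinearMap.ker T.toFun)
  finite_coker : Module.Finite ℂ (E ⧸ ran T)

/-- A B-Fredholm operator of index `0`: for some `n` the range `R(Tⁿ)` is closed and the
restriction `Tₙ` of `T` to `R(Tⁿ)` is a Fredholm operator of index `0`. (For a closed operator
with non-empty resolvent set, the index of `Tₙ` is the same for all `n` for which `R(Tⁿ)` is
closed and `Tₙ` is Fredholm, and this common value is the index of the B-Fredholm operator.) -/
def IsBWeyl (T : E →ₗ.[ℂ] E) : Prop :=
  ∃ n : ℕ, IsClosed (ran (iter T n) : Set E) ∧ IsFredholm (restrictRan T n) ∧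
    index (restrictRan T n) = 0

/-- `c` belongs to the resolvent set: `T - c I` is a bijection from the domain of `T` onto `E`
with a bounded inverse `R`. -/
def resolventSet (T : E →ₗ.[ℂ] E) : Set ℂ :=
  {c | ∃ R : E →L[ℂ] E, (∀ x : T.domain, R (shift T c x) = x) ∧
    ∀ y : E, ∃ h : R y ∈ T.domain, shift T c ⟨R y, h⟩ = y}

/-- The spectrum `σ(T)`. -/
def spec (T : E →ₗ.[ℂ] E) : Set ℂ := (resolventSet T)ᶜ

/-- The B-Weyl spectrum. -/
def bWeylSpec (T : E →ₗ.[ℂ] E) : Set ℂ := {c | ¬ IsBWeyl (shift T c)}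

/-- The B-discrete spectrum. -/
def bDiscreteSpec (T : E →ₗ.[ℂ] E) : Set ℂ := spec T \ bWeylSpec T

end Normed

/-- The isolated points of a set `A`: the points of `A` that have a neighbourhood containing no
other point of `A`. The accumulation points of `A` form Mathlib's `derivedSet A`. -/
def isoPts (A : Set ℂ) : Set ℂ := {z | z ∈ A ∧ ∃ U ∈ 𝓝 z, U ∩ A = {z}}

/-- A Weyl sequence for `T` at `c`: a sequence of unit vectors in the domain of `T` that converges
weakly to `0` and satisfies `‖(T - c) uₙ‖ → 0`. -/
structure IsWeylSeq {H : Type*} [NormedAddCommGroup H] [InnerProductSpace ℂ H]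
    (T : H →ₗ.[ℂ] H) (c : ℂ) (u : ℕ → T.domain) : Prop where
  norm_eq_one : ∀ n, ‖(u n : H)‖ = 1
  weakly_zero : ∀ y : H, Tendsto (fun n => inner ℂ y (u n : H)) atTop (𝓝 0)
  norm_tendsto : Tendsto (fun n => ‖T (u n) - c • (u n : H)‖) atTop (𝓝 0)

end UnbddOp

end

noncomputable section

namespace UnbddOp

open scoped ComplexConjugate

local notation "⟪" x ", " y "⟫" => inner ℂ x y

/-! ### Closed operators, shifts and eigenspaces. -/

section Closed

variable {E : Type*} [NormedAddCommGroup E] [NormedSpace ℂ E]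

/-! Everything rests on `T - c` being B-Weyl exactly when `c` is not an accumulation point of the
spectrum (`isBWeyl_shift_iff`). The iterates of `T - c` are handled through the bounded operator `B
= (T - c)(T - d)⁻¹` with `d` nonreal: it is normal, and `(T - c)ⁿ` and `Bⁿ` have the same range.

If `c` is not an accumulation point, then 0 is at most isolated in the spectrum of `B`, and the
functional calculus gives `G` commuting with `B` such that `B G B = B`. Hence `T - c` is bijective
on its closed range, and `n = 1` works.

Conversely, the B-Weyl property makes the range of some positive power of `B` closed. Powers of a
normal operator have the same kernel, so `T - c` is bounded below on the orthogonal complement of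
its null space. For real `c` this leaves a punctured neighbourhood of `c` in the resolvent set
(`not_mem_derivedSet_of_bound`).

The same criterion shows that the spectrum is closed and, when the lower bound fails, yields Weyl
sequences at accumulation points. -/

theorem mem_graph_shift (T : E →ₗ.[ℂ] E) (c : ℂ) (p : E × E) :
    p ∈ (shift T c).graph ↔ (p.1, p.2 + c • p.1) ∈ T.graph := by
  simp only [LinearPMap.mem_graph_iff]
  constructor
  · rintro ⟨y, hy, h⟩
    refine ⟨y, hy, ?_⟩
    have h' : T y - c • (y : E) = p.2 := h
    rw [← h', ← hy]
    simp
  · rintro ⟨y, hy, h⟩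
    refine ⟨y, hy, ?_⟩
    change T y - c • (y : E) = p.2
    rw [h, ← hy]
    simp

theorem isClosed_shift {T : E →ₗ.[ℂ] E} (hT : T.IsClosed) (c : ℂ) : (shift T c).IsClosed := by
  have h : ((shift T c).graph : Set (E × E)) =
      (fun p : E × E => (p.1, p.2 + c • p.1)) ⁻¹' (T.graph : Set (E × E)) := by
    ext p
    exact mem_graph_shift T c p
  rw [LinearPMap.IsClosed, h]
  exact IsClosed.preimage (by fun_prop) hT

theorem isClosed_restrictRan {T : E →ₗ.[ℂ] E} (hT : T.IsClosed) (n : ℕ) :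
    (restrictRan T n).IsClosed := by
  have h : ((restrictRan T n).graph : Set (ran (iter T n) × ran (iter T n))) =
      (fun p : ran (iter T n) × ran (iter T n) => ((p.1 : E), (p.2 : E))) ⁻¹'
        (T.graph : Set (E × E)) := by
    ext p
    simp only [SetLike.mem_coe, LinearPMap.mem_graph_iff, Set.mem_preimage]
    constructor
    · rintro ⟨y, hy, h⟩
      exact ⟨⟨y, y.2⟩, by rw [← hy], by rw [← h]; rfl⟩
    · rintro ⟨y, hy, h⟩
      exact ⟨⟨p.1, show (p.1 : E) ∈ T.domain from hy ▸ y.2⟩, rfl, Subtype.ext (by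
        rw [← h]
        exact congrArg T (Subtype.ext hy.symm))⟩
  rw [LinearPMap.IsClosed, h]
  exact IsClosed.preimage (by fun_prop) hT

/-- The range of a closed operator that is bounded below is closed. -/
theorem isClosed_ran_of_bound [CompleteSpace E] {S : E →ₗ.[ℂ] E} (hS : S.IsClosed) {δ : ℝ}
    (hδ : 0 < δ) (hb : ∀ x : S.domain, δ * ‖(x : E)‖ ≤ ‖S x‖) :
    IsClosed (ran S : Set E) := by
  have : CompleteSpace S.graph := hS.completeSpace_coe
  let f : S.graph →L[ℂ] E := (ContinuousLinearMap.snd ℂ E E).comp S.graph.subtypeL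
  -- The graph carries the max norm: `δ⁻¹` controls the first coordinate and `1` the second.
  have hf : AntilipschitzWith (Real.toNNReal (max δ⁻¹ 1)) f := by
    refine f.antilipschitz_of_bound fun p => ?_
    obtain ⟨y, hy, h⟩ := (LinearPMap.mem_graph_iff S).1 p.2
    have h1 := hb y
    rw [hy, h] at h1
    rw [Real.coe_toNNReal _ (le_max_of_le_right zero_le_one)]
    change max ‖p.1.1‖ ‖p.1.2‖ ≤ max δ⁻¹ 1 * ‖p.1.2‖
    refine max_le ?_ ?_
    · calc ‖p.1.1‖ = δ⁻¹ * (δ * ‖p.1.1‖) := by field_simp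
        _ ≤ δ⁻¹ * ‖p.1.2‖ := by gcongr
        _ ≤ _ := by gcongr; exact le_max_left _ _
    · calc ‖p.1.2‖ = 1 * ‖p.1.2‖ := by ring
        _ ≤ _ := by gcongr; exact le_max_right _ _
  have hr : (ran S : Set E) = Set.range f := by
    ext y
    constructor
    · rintro ⟨x, rfl⟩
      exact ⟨⟨_, S.mem_graph x⟩, rfl⟩
    · rintro ⟨p, rfl⟩
      obtain ⟨y, hy, h⟩ := (LinearPMap.mem_graph_iff S).1 p.2
      exact ⟨y, h⟩
  rw [hr]
  exact hf.isClosed_range f.uniformContinuous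

/-- The eigenspace of `T` at `c`, as a subspace of `E`. -/
def nullSpace (T : E →ₗ.[ℂ] E) (c : ℂ) : Submodule ℂ E :=
  (LinearMap.ker (shift T c).toFun).map T.domain.subtype

theorem mem_nullSpace {T : E →ₗ.[ℂ] E} {c : ℂ} {x : E} :
    x ∈ nullSpace T c ↔ ∃ h : x ∈ T.domain, T ⟨x, h⟩ - (c : ℂ) • x = 0 := by
  constructor
  · rintro ⟨y, hy, rfl⟩
    exact ⟨y.2, hy⟩
  · rintro ⟨h, hx⟩
    exact ⟨⟨x, h⟩, hx, rfl⟩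

end Closed

/-! ### Lower bounds and the resolvent set of a self-adjoint operator. -/

section SelfAdjoint

variable {H : Type*} [NormedAddCommGroup H] [InnerProductSpace ℂ H] [CompleteSpace H]
  {T : H →ₗ.[ℂ] H}

theorem inner_apply_eq (hT : IsSelfAdjoint T) (x y : T.domain) :
    ⟪T x, (y : H)⟫ = ⟪(x : H), T y⟫ := by
  have h := LinearPMap.adjoint_isFormalAdjoint hT.dense_domain
  rw [LinearPMap.isSelfAdjoint_def.1 hT] at h
  exact h x y

/-- Orthogonality to the range of `T - c` puts `y` in the domain of the adjoint, which is `T`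
itself. -/
theorem exists_mem_domain_of_inner_shift_eq_zero (hT : IsSelfAdjoint T) (c : ℂ) (y : H)
    (hy : ∀ x : T.domain, ⟪y, T x - (c : ℂ) • (x : H)⟫ = 0) :
    ∃ h : y ∈ T.domain, T ⟨y, h⟩ = conj c • y := by
  have hy' : ∀ x : T.domain, ⟪conj c • y, (x : H)⟫ = ⟪y, T x⟫ := by
    intro x
    have h := hy x
    rw [inner_sub_right, inner_smul_right, sub_eq_zero] at h
    rw [h, inner_smul_left, Complex.conj_conj]
  have hd := LinearPMap.mem_adjoint_domain_of_exists y ⟨_, hy'⟩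
  have ha := LinearPMap.adjoint_apply_eq hT.dense_domain ⟨y, hd⟩ hy'
  have hg : (y, conj c • y) ∈ T.adjoint.graph := by
    rw [← ha]
    exact T.adjoint.mem_graph ⟨y, hd⟩
  rw [LinearPMap.isSelfAdjoint_def.1 hT] at hg
  obtain ⟨⟨z, hz⟩, h1, h2⟩ := (LinearPMap.mem_graph_iff T).1 hg
  change z = y at h1
  subst h1
  exact ⟨hz, h2⟩

/-- The lower bound gives injectivity, closed range and the norm `δ⁻¹` of the inverse; a vector
orthogonal to the range is an eigenvector at `conj c`, which `hk` excludes. -/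
theorem mem_resolventSet_of_bound (hT : IsSelfAdjoint T) {c : ℂ} {δ : ℝ} (hδ : 0 < δ)
    (hb : ∀ x : T.domain, δ * ‖(x : H)‖ ≤ ‖T x - (c : ℂ) • (x : H)‖)
    (hk : ∀ x : T.domain, T x = conj c • (x : H) → (x : H) = 0) : c ∈ resolventSet T := by
  have hcl := isClosed_ran_of_bound (isClosed_shift hT.isClosed c) hδ hb
  have : CompleteSpace (ran (shift T c)) := hcl.completeSpace_coe
  have htop : ran (shift T c) = ⊤ := by
    rw [← Submodule.orthogonal_eq_bot_iff, eq_bot_iff]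
    intro y hy
    obtain ⟨h, h'⟩ := exists_mem_domain_of_inner_shift_eq_zero hT c y
      fun x => Submodule.inner_left_of_mem_orthogonal (K := ran (shift T c)) ⟨x, rfl⟩ hy
    exact hk ⟨y, h⟩ h'
  have hinj : Function.Injective (shift T c).toFun := by
    rw [injective_iff_map_eq_zero]
    intro x hx
    have h := hb x
    have h1 : T x - c • (x : H) = 0 := hx
    rw [h1, norm_zero] at h
    have h0 : ‖(x : H)‖ ≤ 0 := by
      by_contra! h0
      exact absurd h (not_le.2 (mul_pos hδ h0))
    exact Subtype.ext (norm_le_zero_iff.1 h0)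
  let e : (shift T c).domain ≃ₗ[ℂ] H :=
    LinearEquiv.ofBijective (shift T c).toFun ⟨hinj, LinearMap.range_eq_top.1 htop⟩
  refine ⟨LinearMap.mkContinuous ((shift T c).domain.subtype ∘ₗ e.symm.toLinearMap) δ⁻¹ ?_, ?_, ?_⟩
  · intro y
    have h : δ * ‖((e.symm y : (shift T c).domain) : H)‖ ≤ ‖e (e.symm y)‖ := hb (e.symm y)
    rw [e.apply_symm_apply] at h
    change ‖((e.symm y : (shift T c).domain) : H)‖ ≤ _
    rw [inv_mul_eq_div, le_div_iff₀ hδ, mul_comm]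
    exact h
  · intro x
    exact congrArg Subtype.val (e.symm_apply_apply x)
  · intro y
    exact ⟨(e.symm y).2, e.apply_symm_apply y⟩

theorem im_inner_apply_self (hT : IsSelfAdjoint T) (x : T.domain) : (⟪(x : H), T x⟫).im = 0 := by
  have h := inner_conj_symm (𝕜 := ℂ) (x : H) (T x)
  rw [inner_apply_eq hT] at h
  exact Complex.conj_eq_iff_im.1 h

theorem abs_im_mul_norm_le (hT : IsSelfAdjoint T) (c : ℂ) (x : T.domain) :
    |c.im| * ‖(x : H)‖ ≤ ‖T x - (c : ℂ) • (x : H)‖ := by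
  have h : (⟪(x : H), T x - (c : ℂ) • (x : H)⟫).im = -(c.im * ‖(x : H)‖ ^ 2) := by
    rw [inner_sub_right, inner_smul_right, inner_self_eq_norm_sq_to_K, Complex.sub_im,
      im_inner_apply_self hT, zero_sub, RCLike.ofReal_eq_complex_ofReal, ← Complex.ofReal_pow,
      Complex.im_mul_ofReal]
  have h2 : |c.im| * ‖(x : H)‖ ^ 2 ≤ ‖(x : H)‖ * ‖T x - (c : ℂ) • (x : H)‖ := by
    calc |c.im| * ‖(x : H)‖ ^ 2 = |(⟪(x : H), T x - (c : ℂ) • (x : H)⟫).im| := by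
          rw [h, abs_neg, abs_mul, abs_of_nonneg (sq_nonneg ‖(x : H)‖)]
      _ ≤ ‖⟪(x : H), T x - (c : ℂ) • (x : H)⟫‖ := Complex.abs_im_le_norm _
      _ ≤ _ := norm_inner_le_norm _ _
  rcases (norm_nonneg (x : H)).eq_or_lt with h0 | h0
  · rw [← h0, mul_zero]
    exact norm_nonneg _
  · refine le_of_mul_le_mul_left ?_ h0
    linarith [h2]

theorem mem_resolventSet_of_im_ne_zero (hT : IsSelfAdjoint T) {c : ℂ} (hc : c.im ≠ 0) :
    c ∈ resolventSet T := by
  refine mem_resolventSet_of_bound hT (abs_pos.2 hc) (abs_im_mul_norm_le hT c) fun x hx => ?_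
  have h := abs_im_mul_norm_le hT (conj c) x
  rw [hx, sub_self, norm_zero, Complex.conj_im, abs_neg] at h
  by_contra h0
  exact absurd h (not_le.2 (mul_pos (abs_pos.2 hc) (norm_pos_iff.2 h0)))

theorem mem_resolventSet_ofReal_of_bound (hT : IsSelfAdjoint T) {r : ℝ} {δ : ℝ} (hδ : 0 < δ)
    (hb : ∀ x : T.domain, δ * ‖(x : H)‖ ≤ ‖T x - (r : ℂ) • (x : H)‖) : (r : ℂ) ∈ resolventSet T := by
  refine mem_resolventSet_of_bound hT hδ hb fun x hx => ?_
  have h := hb x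
  rw [hx, Complex.conj_ofReal, sub_self, norm_zero] at h
  by_contra h0
  exact absurd h (not_le.2 (mul_pos hδ (norm_pos_iff.2 h0)))

theorem inner_shift_eq (hT : IsSelfAdjoint T) (r : ℝ) (x y : T.domain) :
    ⟪T x - (r : ℂ) • (x : H), (y : H)⟫ = ⟪(x : H), T y - (r : ℂ) • (y : H)⟫ := by
  rw [inner_sub_left, inner_sub_right, inner_apply_eq hT,
    inner_smul_left, inner_smul_right, Complex.conj_ofReal]

theorem orthogonal_ran_shift_le (hT : IsSelfAdjoint T) (r : ℝ) :
    (ran (shift T r))ᗮ ≤ nullSpace T r := by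
  intro y hy
  obtain ⟨h, h'⟩ := exists_mem_domain_of_inner_shift_eq_zero hT r y
    fun x => Submodule.inner_left_of_mem_orthogonal (K := ran (shift T r)) ⟨x, rfl⟩ hy
  rw [Complex.conj_ofReal] at h'
  exact mem_nullSpace.2 ⟨h, by rw [h', sub_self]⟩

theorem orthogonal_ran_shift (hT : IsSelfAdjoint T) (r : ℝ) :
    (ran (shift T r))ᗮ = nullSpace T r := by
  refine le_antisymm (orthogonal_ran_shift_le hT r) fun x hx => ?_
  obtain ⟨h, h'⟩ := mem_nullSpace.1 hx
  rw [Submodule.mem_orthogonal]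
  rintro _ ⟨y, rfl⟩
  have h2 := inner_shift_eq hT r y ⟨x, h⟩
  rw [h', inner_zero_right] at h2
  exact h2

/-- For real `s ≠ r` with `|s - r| < δ`, `T - s` is multiplication by `r - s` on the null space and
is bounded below by `δ - |s - r|` on its orthogonal complement. The two images are orthogonal, so
the bounds combine by Pythagoras. -/
theorem not_mem_derivedSet_of_bound (hT : IsSelfAdjoint T) {r : ℝ} {δ : ℝ} (hδ : 0 < δ)
    (hb : ∀ x : T.domain, (x : H) ∈ (nullSpace T r)ᗮ → δ * ‖(x : H)‖ ≤ ‖T x - (r : ℂ) • (x : H)‖) :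
    (r : ℂ) ∉ derivedSet (spec T) := by
  rw [mem_derivedSet, accPt_iff_frequently, not_frequently]
  filter_upwards [Metric.ball_mem_nhds (r : ℂ) hδ] with z hz
  rintro ⟨hne, hs⟩
  refine hs ?_
  by_cases him : z.im = 0
  swap
  · exact mem_resolventSet_of_im_ne_zero hT him
  obtain ⟨s, rfl⟩ : ∃ s : ℝ, (s : ℂ) = z := ⟨z.re, Complex.ext rfl him.symm⟩
  have hsr : |s - r| < δ := by
    rw [Metric.mem_ball, Complex.dist_eq, ← Complex.ofReal_sub, Complex.norm_real] at hz
    exact hz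
  have hsr0 : 0 < |s - r| := by
    rw [abs_pos, sub_ne_zero]
    rintro rfl
    exact hne rfl
  set m := min |s - r| (δ - |s - r|) with hm
  have hm0 : 0 < m := lt_min hsr0 (by linarith)
  refine mem_resolventSet_ofReal_of_bound hT hm0 fun x => ?_
  have hclN : IsClosed (nullSpace T r : Set H) := by
    rw [← orthogonal_ran_shift hT]
    exact Submodule.isClosed_orthogonal _
  have : CompleteSpace (nullSpace T r) := hclN.completeSpace_coe
  obtain ⟨p, hp, q, hq, hpq⟩ := (nullSpace T r).exists_add_mem_mem_orthogonal (x : H)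
  obtain ⟨hpd, hp0⟩ := mem_nullSpace.1 hp
  have hqd : q ∈ T.domain := by
    have : q = x - p := by rw [hpq]; abel
    rw [this]
    exact sub_mem x.2 hpd
  have hxe : x = ⟨p, hpd⟩ + ⟨q, hqd⟩ := Subtype.ext hpq
  have hTp : T ⟨p, hpd⟩ = (r : ℂ) • p := by
    rw [sub_eq_zero] at hp0
    exact hp0
  have hSx : T x - (s : ℂ) • (x : H) = ((r : ℂ) - s) • p + (T ⟨q, hqd⟩ - (s : ℂ) • q) := by
    rw [hxe, T.map_add, hTp]
    simp only [Submodule.coe_add]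
    module
  have horth1 : ⟪p, q⟫ = 0 := Submodule.inner_right_of_mem_orthogonal hp hq
  have horth2 : ⟪((r : ℂ) - s) • p, T ⟨q, hqd⟩ - (s : ℂ) • q⟫ = 0 := by
    have h1 := inner_shift_eq hT r ⟨p, hpd⟩ ⟨q, hqd⟩
    rw [hp0, inner_zero_left, inner_sub_right, inner_smul_right] at h1
    simp only [horth1, mul_zero, sub_zero] at h1
    rw [inner_smul_left, inner_sub_right, inner_smul_right, ← h1, horth1]
    simp
  have hq1 : m * ‖q‖ ≤ ‖T ⟨q, hqd⟩ - (s : ℂ) • q‖ := by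
    have h1 := hb ⟨q, hqd⟩ hq
    have h2 : T ⟨q, hqd⟩ - (r : ℂ) • q = T ⟨q, hqd⟩ - (s : ℂ) • q + ((s : ℂ) - r) • q := by
      module
    have h3 : ‖((s : ℂ) - r) • q‖ = |s - r| * ‖q‖ := by
      rw [norm_smul, ← Complex.ofReal_sub, Complex.norm_real, Real.norm_eq_abs]
    rw [h2] at h1
    have h4 := norm_add_le (T ⟨q, hqd⟩ - (s : ℂ) • q) (((s : ℂ) - r) • q)
    rw [h3] at h4
    have h5 : m * ‖q‖ ≤ (δ - |s - r|) * ‖q‖ := by gcongr; exact min_le_right _ _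
    have h6 : δ * ‖q‖ ≤ ‖T ⟨q, hqd⟩ - (s : ℂ) • q‖ + |s - r| * ‖q‖ := h1.trans h4
    linarith
  have hp1 : m * ‖p‖ ≤ ‖((r : ℂ) - s) • p‖ := by
    rw [norm_smul, ← Complex.ofReal_sub, Complex.norm_real, Real.norm_eq_abs, abs_sub_comm]
    gcongr
    exact min_le_left _ _
  have e1 := norm_add_sq_eq_norm_sq_add_norm_sq_of_inner_eq_zero (𝕜 := ℂ) p q horth1
  have e2 := norm_add_sq_eq_norm_sq_add_norm_sq_of_inner_eq_zero (𝕜 := ℂ) _ _ horth2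
  rw [← hSx] at e2
  rw [← hpq] at e1
  refine le_of_sq_le_sq ?_ (norm_nonneg _)
  have e3 : (m * ‖p‖) * (m * ‖p‖) ≤ _ := mul_self_le_mul_self (by positivity) hp1
  have e4 : (m * ‖q‖) * (m * ‖q‖) ≤ _ := mul_self_le_mul_self (by positivity) hq1
  have e5 : (m * ‖(x : H)‖) ^ 2 = m * ‖p‖ * (m * ‖p‖) + m * ‖q‖ * (m * ‖q‖) := by
    linear_combination m ^ 2 * e1
  linarith [e2, e3, e4, e5, sq ‖T x - (s : ℂ) • (x : H)‖]

end SelfAdjoint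

/-! ### Reduction of `T - c` and its iterates to a bounded operator. -/

section Resolvent

variable {E : Type*} [NormedAddCommGroup E] [NormedSpace ℂ E]

/-- `R` is the resolvent `(T - c)⁻¹`. -/
structure IsResolvent (T : E →ₗ.[ℂ] E) (c : ℂ) (R : E →L[ℂ] E) : Prop where
  left_inv : ∀ x : T.domain, R (T x - c • (x : E)) = x
  right_inv : ∀ y : E, ∃ h : R y ∈ T.domain, T ⟨R y, h⟩ - c • R y = y

theorem mem_resolventSet_iff {T : E →ₗ.[ℂ] E} {c : ℂ} :
    c ∈ resolventSet T ↔ ∃ R, IsResolvent T c R :=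
  ⟨fun ⟨R, h1, h2⟩ => ⟨R, h1, h2⟩, fun ⟨R, h⟩ => ⟨R, h.left_inv, h.right_inv⟩⟩

namespace IsResolvent

variable {T : E →ₗ.[ℂ] E} {c d : ℂ} {R Q : E →L[ℂ] E}

theorem mem_domain (hR : IsResolvent T c R) (y : E) : R y ∈ T.domain := (hR.right_inv y).1

theorem apply_eq (hR : IsResolvent T c R) (y : E) :
    T ⟨R y, hR.mem_domain y⟩ - c • R y = y := (hR.right_inv y).2

theorem injective (hR : IsResolvent T c R) : Function.Injective R := by
  intro x y h
  rw [← hR.apply_eq x, ← hR.apply_eq y]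
  simp only [h]

theorem sub_eq (hR : IsResolvent T c R) (hQ : IsResolvent T d Q) :
    Q - R = (d - c) • (R * Q) := by
  ext y
  have h := hR.left_inv ⟨Q y, hQ.mem_domain y⟩
  have h2 : T ⟨Q y, hQ.mem_domain y⟩ - c • Q y = y + (d - c) • Q y := by
    rw [sub_eq_iff_eq_add.1 (hQ.apply_eq y)]
    module
  simp only [h2, map_add, map_smul] at h
  exact sub_eq_iff_eq_add'.2 h.symm

theorem commute (hR : IsResolvent T c R) (hQ : IsResolvent T d Q) : Commute R Q := by
  by_cases hcd : d = c
  · subst hcd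
    have h := hR.sub_eq hQ
    rw [sub_self, zero_smul, sub_eq_zero] at h
    rw [h]
  · have h : (d - c) • (R * Q) = (d - c) • (Q * R) := by
      rw [← hR.sub_eq hQ, ← neg_sub c d, neg_smul, ← hQ.sub_eq hR, neg_sub]
    exact smul_right_injective _ (sub_ne_zero.2 hcd) h

/-- The inverse `1 + (d - c) • Q` comes from the resolvent identity. -/
theorem isUnit_one_sub (hR : IsResolvent T c R) (hQ : IsResolvent T d Q) :
    IsUnit (1 - (d - c) • R) := by
  have h1 := hR.sub_eq hQ
  have h2 : Q - R = (d - c) • (Q * R) := by rw [h1, (hR.commute hQ).eq]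
  refine ⟨⟨1 - (d - c) • R, 1 + (d - c) • Q, ?_, ?_⟩, rfl⟩
  · have : (1 - (d - c) • R) * (1 + (d - c) • Q)
        = 1 + (d - c) • ((Q - R) - (d - c) • (R * Q)) := by
      simp only [mul_add, sub_mul, one_mul, mul_one, smul_mul_assoc, mul_smul_comm]
      module
    rw [this, h1, sub_self, smul_zero, add_zero]
  · have : (1 + (d - c) • Q) * (1 - (d - c) • R)
        = 1 + (d - c) • ((Q - R) - (d - c) • (Q * R)) := by
      simp only [add_mul, mul_sub, one_mul, mul_one, smul_mul_assoc, mul_smul_comm]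
      module
    rw [this, h2, sub_self, smul_zero, add_zero]

end IsResolvent

/-- The bounded operator `(T - c)(T - d)⁻¹ = 1 + (d - c) R`, where `R = (T - d)⁻¹`. -/
def bddShift (R : E →L[ℂ] E) (d c : ℂ) : E →L[ℂ] E := 1 + (d - c) • R

theorem bddShift_apply (R : E →L[ℂ] E) (d c : ℂ) (x : E) :
    bddShift R d c x = x + (d - c) • R x := rfl

theorem commute_bddShift (R : E →L[ℂ] E) (d c : ℂ) : Commute R (bddShift R d c) :=
  (Commute.one_right R).add_right ((Commute.refl R).smul_right (d - c))

namespace IsResolvent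

variable {T : E →ₗ.[ℂ] E} {c d : ℂ} {R : E →L[ℂ] E}

theorem shift_apply_resolvent (hR : IsResolvent T d R) (c : ℂ) (y : E) :
    T ⟨R y, hR.mem_domain y⟩ - c • R y = bddShift R d c y := by
  have h := hR.apply_eq y
  rw [sub_eq_iff_eq_add] at h
  rw [h, bddShift_apply]
  module

theorem resolvent_apply_shift (hR : IsResolvent T d R) (c : ℂ) (x : T.domain) :
    R (T x - c • (x : E)) = bddShift R d c x := by
  have h : T x - c • (x : E) = (T x - d • (x : E)) + (d - c) • (x : E) := by module
  rw [h, map_add, hR.left_inv, map_smul, bddShift_apply]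

theorem mem_domain_of_bddShift_mem (hR : IsResolvent T d R) {c : ℂ} {x : E}
    (hx : bddShift R d c x ∈ T.domain) : x ∈ T.domain := by
  have h : x = bddShift R d c x - (d - c) • R x := by rw [bddShift_apply]; abel
  rw [h]
  exact sub_mem hx (Submodule.smul_mem _ _ (hR.mem_domain x))

theorem mem_domain_of_bddShift_pow_mem (hR : IsResolvent T d R) {c : ℂ} {x : E} (n : ℕ)
    (hx : (bddShift R d c ^ n) x ∈ T.domain) : x ∈ T.domain := by
  induction n with
  | zero => exact hx
  | succ n ih =>
    rw [pow_succ'] at hx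
    exact ih (hR.mem_domain_of_bddShift_mem hx)

theorem mem_ran_iter_shift_iff (hR : IsResolvent T d R) (c : ℂ) (n : ℕ) (y : E) :
    y ∈ ran (iter (shift T c) n) ↔ ∃ w, (bddShift R d c ^ n) w = y := by
  have hcomm : ∀ n w, R ((bddShift R d c ^ n) w) = (bddShift R d c ^ n) (R w) := fun n w =>
    DFunLike.congr_fun ((commute_bddShift R d c).pow_right n).eq w
  induction n generalizing y with
  | zero =>
    rw [ran_iter_zero]
    exact ⟨fun _ => ⟨y, rfl⟩, fun _ => Submodule.mem_top⟩
  | succ n ih =>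
    rw [mem_ran_iter_succ]
    constructor
    · rintro ⟨⟨x, hx⟩, hxr, hxy⟩
      have hxy' : T ⟨x, hx⟩ - c • x = y := hxy
      obtain ⟨w, rfl⟩ := (ih x).1 hxr
      have hw := hR.mem_domain_of_bddShift_pow_mem n hx
      have hv := hR.left_inv ⟨w, hw⟩
      set v := T ⟨w, hw⟩ - d • w
      change R v = w at hv
      -- Since `w = R v`, applying `T - c` to `Bⁿ w = R (Bⁿ v)` gives `Bⁿ⁺¹ v`.
      refine ⟨v, ?_⟩
      rw [← hxy', pow_succ']
      change bddShift R d c ((bddShift R d c ^ n) v) = _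
      rw [← hR.shift_apply_resolvent]
      simp only [hcomm, hv]
    · rintro ⟨w, rfl⟩
      refine ⟨⟨R ((bddShift R d c ^ n) w), hR.mem_domain _⟩, (ih _).2 ⟨R w, (hcomm n w).symm⟩, ?_⟩
      rw [pow_succ']
      exact hR.shift_apply_resolvent c _

theorem mem_nullSpace_of_bddShift_eq_zero (hR : IsResolvent T d R) {c : ℂ} {x : E}
    (hx : bddShift R d c x = 0) : x ∈ nullSpace T c := by
  have h : x ∈ T.domain := hR.mem_domain_of_bddShift_mem (hx ▸ zero_mem T.domain)
  refine mem_nullSpace.2 ⟨h, hR.injective ?_⟩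
  rw [map_zero, ← hx]
  exact hR.resolvent_apply_shift c ⟨x, h⟩

end IsResolvent

theorem isBWeyl_of_bijective {S : E →ₗ.[ℂ] E} (hS : S.IsClosed) (n : ℕ)
    (hcl : IsClosed (ran (iter S n) : Set E))
    (hinj : ∀ x : S.domain, (x : E) ∈ ran (iter S n) → S x = 0 → (x : E) = 0)
    (hsurj : ran (iter S n) ≤ ran (iter S (n + 1))) : IsBWeyl S := by
  have hker : LinearMap.ker (restrictRan S n).toFun = ⊥ := by
    rw [eq_bot_iff]
    intro x hx
    have hx' : restrictRan S n x = 0 := hx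
    have := hinj ⟨(x : ran (iter S n)), x.2⟩ x.1.2 (congrArg Subtype.val hx')
    exact Subtype.ext (Subtype.ext this)
  have hran : ran (restrictRan S n) = ⊤ := by
    rw [eq_top_iff]
    intro y _
    obtain ⟨x, hx, hxy⟩ := (mem_ran_iter_succ S n y).1 (hsurj y.2)
    exact ⟨⟨⟨x, hx⟩, x.2⟩, Subtype.ext hxy⟩
  have h1 : Subsingleton (LinearMap.ker (restrictRan S n).toFun) := by
    rw [hker]
    infer_instance
  have h2 : Subsingleton (ran (iter S n) ⧸ ran (restrictRan S n)) :=
    Submodule.Quotient.subsingleton_iff.2 hran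
  refine ⟨n, hcl, ⟨isClosed_restrictRan hS n, inferInstance, inferInstance⟩, ?_⟩
  rw [index, Module.finrank_zero_of_subsingleton, Module.finrank_zero_of_subsingleton, sub_self]

/-- `B G` is a bounded projection onto the range of `B`, so this range is closed; `G` inverts `B` on
it. -/
theorem IsResolvent.isBWeyl_shift {T : E →ₗ.[ℂ] E} {c d : ℂ} {R G : E →L[ℂ] E}
    (hT : T.IsClosed) (hR : IsResolvent T d R) (hcomm : Commute (bddShift R d c) G)
    (hG : bddShift R d c * G * bddShift R d c = bddShift R d c) : IsBWeyl (shift T c) := by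
  set B := bddShift R d c with hB
  have hG' : ∀ x, B (G (B x)) = B x := fun x => DFunLike.congr_fun hG x
  have hGB : ∀ x, B (G x) = G (B x) := fun x => DFunLike.congr_fun hcomm.eq x
  have hran : ∀ y, y ∈ ran (iter (shift T c) 1) ↔ B (G y) = y := by
    intro y
    rw [hR.mem_ran_iter_shift_iff, pow_one]
    exact ⟨fun ⟨w, hw⟩ => by rw [← hw]; exact hG' w, fun h => ⟨_, h⟩⟩
  refine isBWeyl_of_bijective (isClosed_shift hT c) 1 ?_ ?_ ?_
  · have : (ran (iter (shift T c) 1) : Set E) = {y | B (G y) = y} := Set.ext hran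
    rw [this]
    exact isClosed_eq (by fun_prop) continuous_id
  · intro x hx hx0
    have h0 : B x = 0 := by
      rw [hB, ← hR.resolvent_apply_shift c x]
      exact (congrArg R hx0).trans (map_zero R)
    rw [← (hran x).1 hx, hGB, h0, map_zero]
  · intro y hy
    rw [hR.mem_ran_iter_shift_iff]
    refine ⟨G (G y), ?_⟩
    rw [pow_two]
    change B (B (G (G y))) = y
    rw [hGB, hGB, (hran y).1 hy, ← hGB, (hran y).1 hy]

/-- Spectral mapping: for `d ≠ c` the point in `h` is the solution `z` of `(z - c) / (z - d) = w`.
-/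
theorem IsResolvent.not_mem_spectrum_bddShift {c d w : ℂ} {R : E →L[ℂ] E}
    {T : E →ₗ.[ℂ] E}
    (hR : IsResolvent T d R) (hw : w ≠ 1)
    (h : c - (d - c) * w / (1 - w) ∈ resolventSet T) : w ∉ spectrum ℂ (bddShift R d c) := by
  obtain ⟨Q, hQ⟩ := mem_resolventSet_iff.1 h
  have hw' : 1 - w ≠ 0 := sub_ne_zero.2 hw.symm
  have hu := hR.isUnit_one_sub hQ
  rw [spectrum.notMem_iff]
  have he : algebraMap ℂ (E →L[ℂ] E) w - bddShift R d c =
      (-(1 - w)) • (1 - (c - (d - c) * w / (1 - w) - d) • R) := by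
    rw [Algebra.algebraMap_eq_smul_one, bddShift, smul_sub, smul_smul]
    have : -(1 - w) * (c - (d - c) * w / (1 - w) - d) = d - c := by
      field_simp
      ring
    rw [this]
    module
  rw [he]
  exact hu.smul (Units.mk0 (-(1 - w)) (neg_ne_zero.2 hw'))

end Resolvent

/-! ### Kernels and generalized inverses of bounded normal operators. -/

section Normal

variable {H : Type*} [NormedAddCommGroup H] [InnerProductSpace ℂ H] [CompleteSpace H]

/-- `N` and its adjoint have the same kernel, so `N (N z) = 0` gives `‖N z‖² = ⟪N* N z, z⟫ = 0`. -/
theorem apply_eq_zero_of_pow_apply_eq_zero {N : H →L[ℂ] H} (hN : IsStarNormal N) (k : ℕ) {x : H}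
    (hx : (N ^ (k + 1)) x = 0) : N x = 0 := by
  induction k with
  | zero => simpa using hx
  | succ k ih =>
    refine ih ?_
    rw [pow_succ', pow_succ'] at hx
    change N (N ((N ^ k) x)) = 0 at hx
    rw [pow_succ']
    change N ((N ^ k) x) = 0
    rw [← ContinuousLinearMap.IsStarNormal.adjoint_apply_eq_zero_iff hN] at hx
    rw [← inner_self_eq_zero (𝕜 := ℂ), ← ContinuousLinearMap.adjoint_inner_left, hx,
      inner_zero_left]

theorem exists_commute_mul_mul_eq {N : H →L[ℂ] H} (hN : IsStarNormal N)
    (h : ∀ᶠ w in 𝓝 (0 : ℂ), w ≠ 0 → w ∉ spectrum ℂ N) :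
    ∃ G : H →L[ℂ] H, Commute N G ∧ N * G * N = N := by
  -- With `0⁻¹ = 0`, inversion is continuous on the spectrum as 0 is not a limit point of it, and `w
  -- * w⁻¹ * w = w` holds at 0 too.
  have hc : ContinuousOn (fun w : ℂ => w⁻¹) (spectrum ℂ N) := by
    intro w hw
    by_cases hw0 : w = 0
    · subst hw0
      have : (fun w : ℂ => w⁻¹) =ᶠ[𝓝[spectrum ℂ N] 0] fun _ => 0 := by
        rw [EventuallyEq, eventually_nhdsWithin_iff]
        filter_upwards [h] with z hz hzs
        by_contra hz0
        exact hz (fun h0 => hz0 (by rw [h0, inv_zero])) hzs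
      exact continuousWithinAt_const.congr_of_eventuallyEq this inv_zero
    · exact (continuousAt_inv₀ hw0).continuousWithinAt
  have hid : cfc (fun w : ℂ => w) N = N := cfc_id' ℂ N
  refine ⟨cfc (fun w : ℂ => w⁻¹) N, ?_, ?_⟩
  · nth_rewrite 1 [← hid]
    exact cfc_commute_cfc _ _ N
  · have h1 : N * cfc (fun w : ℂ => w⁻¹) N = cfc (fun w : ℂ => w * w⁻¹) N := by
      rw [cfc_mul (fun w : ℂ => w) _ N continuousOn_id hc, hid]
    have h2 : cfc (fun w : ℂ => w * w⁻¹ * w) N = cfc (fun w : ℂ => w * w⁻¹) N * N := by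
      rw [cfc_mul (fun w : ℂ => w * w⁻¹) (fun w => w) N (continuousOn_id.mul hc) continuousOn_id,
        hid]
    rw [h1, ← h2]
    simp only [mul_inv_mul_cancel, hid]

end Normal

/-! ### Points that are not accumulation points are B-Weyl. -/

section SelfAdjoint

variable {H : Type*} [NormedAddCommGroup H] [InnerProductSpace ℂ H] [CompleteSpace H]
  {T : H →ₗ.[ℂ] H}

/-- The adjoint of `R` is the resolvent at `conj d`, and resolvents commute. -/
theorem IsResolvent.isStarNormal (hT : IsSelfAdjoint T) {d : ℂ} (hd : d.im ≠ 0) {R : H →L[ℂ] H}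
    (hR : IsResolvent T d R) : IsStarNormal R := by
  have hd' : (conj d).im ≠ 0 := by rwa [Complex.conj_im, neg_ne_zero]
  obtain ⟨Q, hQ⟩ := mem_resolventSet_iff.1 (mem_resolventSet_of_im_ne_zero hT hd')
  have hadj : Q = star R := by
    rw [ContinuousLinearMap.star_eq_adjoint, ContinuousLinearMap.eq_adjoint_iff]
    intro x y
    have h1 := inner_apply_eq hT ⟨Q x, hQ.mem_domain x⟩ ⟨R y, hR.mem_domain y⟩
    have hx := sub_eq_iff_eq_add.1 (hQ.apply_eq x)
    have hy := sub_eq_iff_eq_add.1 (hR.apply_eq y)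
    rw [hx, hy, inner_add_left, inner_add_right, inner_smul_left, inner_smul_right,
      Complex.conj_conj] at h1
    exact (add_right_cancel h1).symm
  exact ⟨hadj ▸ hQ.commute hR⟩

theorem exists_resolvent_ne (hT : IsSelfAdjoint T) (c : ℂ) :
    ∃ d R, d ≠ c ∧ IsResolvent T d R ∧ IsStarNormal (bddShift R d c) := by
  -- The imaginary part is nonzero and exceeds that of `c`, so `d` is nonreal and differs from `c`.
  let d : ℂ := ⟨0, |c.im| + 1⟩
  have hd : d.im ≠ 0 := (by positivity : |c.im| + 1 ≠ 0)
  obtain ⟨R, hR⟩ := mem_resolventSet_iff.1 (mem_resolventSet_of_im_ne_zero hT hd)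
  refine ⟨d, R, fun h => ?_, hR, ?_⟩
  · have h1 : |c.im| + 1 = c.im := congrArg Complex.im h
    linarith [le_abs_self c.im]
  · have := hR.isStarNormal hT hd
    unfold bddShift
    infer_instance

theorem isBWeyl_shift_of_not_mem_derivedSet (hT : IsSelfAdjoint T) {c : ℂ}
    (hc : c ∉ derivedSet (spec T)) : IsBWeyl (shift T c) := by
  obtain ⟨d, R, hdc, hR, hN⟩ := exists_resolvent_ne hT c
  rw [mem_derivedSet, accPt_iff_frequently, not_frequently] at hc
  have ht : Tendsto (fun w : ℂ => c - (d - c) * w / (1 - w)) (𝓝 0) (𝓝 c) := by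
    have : ContinuousAt (fun w : ℂ => c - (d - c) * w / (1 - w)) 0 := by
      refine continuousAt_const.sub (ContinuousAt.div (by fun_prop) (by fun_prop) (by simp))
    simpa [ContinuousAt] using this
  have h1 : ∀ᶠ w : ℂ in 𝓝 0, w ≠ 1 := isOpen_ne.mem_nhds zero_ne_one
  obtain ⟨G, hG1, hG2⟩ := exists_commute_mul_mul_eq hN (by
    filter_upwards [ht.eventually hc, h1] with w hw hw1 hw0
    refine hR.not_mem_spectrum_bddShift hw1 ?_
    by_contra hs
    refine hw ⟨fun he => ?_, hs⟩
    rw [sub_eq_self, div_eq_zero_iff] at he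
    rcases he with he | he
    · exact (mul_ne_zero (sub_ne_zero.2 hdc) hw0) he
    · exact hw1 (sub_eq_zero.1 he).symm)
  exact hR.isBWeyl_shift hT.isClosed hG1 hG2

end SelfAdjoint

/-! ### Bounded operators with closed range. -/

section Preimages

variable {E F : Type*} [NormedAddCommGroup E] [NormedSpace ℂ E] [CompleteSpace E]
  [NormedAddCommGroup F] [NormedSpace ℂ F] [CompleteSpace F]

theorem exists_preimage_norm_le_of_isClosed_range (B : E →L[ℂ] F)
    (hB : IsClosed (Set.range B)) :
    ∃ K > 0, ∀ x, ∃ x', B x' = B x ∧ ‖x'‖ ≤ K * ‖B x‖ := by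
  have hB' : IsClosed ((LinearMap.range (B : E →ₗ[ℂ] F) : Submodule ℂ F) : Set F) := hB
  have : CompleteSpace (LinearMap.range (B : E →ₗ[ℂ] F)) := hB'.completeSpace_coe
  let B' : E →L[ℂ] LinearMap.range (B : E →ₗ[ℂ] F) := B.codRestrict _ fun x => ⟨x, rfl⟩
  obtain ⟨K, hK, h⟩ := B'.exists_preimage_norm_le (by
    rintro ⟨_, x, rfl⟩
    exact ⟨x, rfl⟩)
  refine ⟨K, hK, fun x => ?_⟩
  obtain ⟨x', h1, h2⟩ := h (B' x)
  exact ⟨x', congrArg Subtype.val h1, h2⟩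

/-- For a finite-dimensional complement `G` of the range, `(x, g) ↦ B x + g` is a quotient map by
the open mapping theorem, and the preimage of the range is the closed set `g = 0`. -/
theorem isClosed_range_of_finite_quotient (B : E →L[ℂ] F)
    (hB : Module.Finite ℂ (F ⧸ LinearMap.range (B : E →ₗ[ℂ] F))) : IsClosed (Set.range B) := by
  obtain ⟨G, hG⟩ := Submodule.exists_isCompl (LinearMap.range (B : E →ₗ[ℂ] F))
  have hfin : FiniteDimensional ℂ G :=
    Module.Finite.equiv (Submodule.quotientEquivOfIsCompl _ G hG)
  have : CompleteSpace G := FiniteDimensional.complete ℂ G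
  have hsurj : Function.Surjective (B.coprod G.subtypeL) := by
    intro y
    obtain ⟨_, ⟨x, rfl⟩, g, hg, hy⟩ := Submodule.mem_sup.1
      (hG.sup_eq_top ▸ Submodule.mem_top : y ∈ LinearMap.range (B : E →ₗ[ℂ] F) ⊔ G)
    exact ⟨(x, ⟨g, hg⟩), hy⟩
  rw [← ((B.coprod G.subtypeL).isQuotientMap hsurj).isClosed_preimage]
  have hset : (B.coprod G.subtypeL) ⁻¹' Set.range B = {p : E × G | p.2 = 0} := by
    ext ⟨x, g⟩
    constructor
    · rintro ⟨z, hz⟩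
      change B z = B x + (g : F) at hz
      have hg : (g : F) = B (z - x) := by rw [map_sub, hz, add_sub_cancel_left]
      exact Subtype.ext ((Submodule.disjoint_def.1 hG.disjoint) g ⟨z - x, hg.symm⟩ g.2)
    · rintro (rfl : g = 0)
      exact ⟨x, (add_zero (B x)).symm⟩
  rw [hset]
  exact isClosed_eq continuous_snd continuous_const

end Preimages

/-! ### B-Weyl points are not accumulation points; Weyl sequences. -/

section SelfAdjoint

variable {H : Type*} [NormedAddCommGroup H] [InnerProductSpace ℂ H] [CompleteSpace H]
  {T : H →ₗ.[ℂ] H}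

theorem IsBWeyl.exists_isClosed_ran {T : H →ₗ.[ℂ] H} {c d : ℂ} {R : H →L[ℂ] H}
    (hR : IsResolvent T d R) (h : IsBWeyl (shift T c)) :
    ∃ k : ℕ, IsClosed (Set.range (bddShift R d c ^ (k + 1))) := by
  obtain ⟨n, hcl, hF, -⟩ := h
  have hset : ∀ n, (ran (iter (shift T c) n) : Set H) = Set.range (bddShift R d c ^ n) :=
    fun n => Set.ext (hR.mem_ran_iter_shift_iff c n)
  rcases n with - | n
  -- For `n = 0` closedness of the whole space says nothing; the finite cokernel of `T - c` makes
  -- the range of `B` itself closed.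
  · refine ⟨0, isClosed_range_of_finite_quotient _ ?_⟩
    have := hF.finite_coker
    have hle : ran (restrictRan (shift T c) 0) ≤
        (LinearMap.range ((bddShift R d c ^ (0 + 1) : H →L[ℂ] H) : H →ₗ[ℂ] H)).comap
          (ran (iter (shift T c) 0)).subtype := by
      rintro _ ⟨x, rfl⟩
      exact (hR.mem_ran_iter_shift_iff c 1 _).1
        ((mem_ran_iter_succ _ 0 _).2 ⟨⟨x.1, x.2⟩, x.1.2, rfl⟩)
    refine Module.Finite.of_surjective (Submodule.mapQ _ _ _ hle) ?_
    intro y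
    obtain ⟨y, rfl⟩ := Submodule.mkQ_surjective _ y
    exact ⟨Submodule.Quotient.mk ⟨y, (ran_iter_zero (shift T c)).symm ▸ Submodule.mem_top⟩, rfl⟩
  · exact ⟨n, hset (n + 1) ▸ hcl⟩

theorem exists_bound_of_isBWeyl_shift (hT : IsSelfAdjoint T) {c : ℂ} (h : IsBWeyl (shift T c)) :
    ∃ δ > 0, ∀ x : T.domain, (x : H) ∈ (nullSpace T c)ᗮ →
      δ * ‖(x : H)‖ ≤ ‖T x - c • (x : H)‖ := by
  obtain ⟨d, R, -, hR, hN⟩ := exists_resolvent_ne hT c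
  obtain ⟨k, hk⟩ := h.exists_isClosed_ran hR
  obtain ⟨K, hK, hb⟩ := exists_preimage_norm_le_of_isClosed_range _ hk
  set B := bddShift R d c with hB
  -- The `+ 1` keeps `M` positive even if `B ^ k * R = 0`.
  set M := K * (‖B ^ k * R‖ + 1) with hM
  have hM0 : 0 < M := by positivity
  refine ⟨M⁻¹, by positivity, fun x hx => ?_⟩
  obtain ⟨x', hx', hxn⟩ := hb x
  have hmem : (x : H) - x' ∈ nullSpace T c := by
    refine hR.mem_nullSpace_of_bddShift_eq_zero (apply_eq_zero_of_pow_apply_eq_zero hN k ?_)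
    rw [map_sub, hx', sub_self]
  -- As `x` is orthogonal to `x - x'`, it is the shortest vector of its coset modulo the null space.
  have hle : ‖(x : H)‖ ≤ ‖x'‖ := by
    have h1 : ⟪(x : H), (x : H) - x'⟫ = 0 := Submodule.inner_left_of_mem_orthogonal hmem hx
    rw [inner_sub_right, sub_eq_zero, inner_self_eq_norm_sq_to_K] at h1
    have h2 := norm_inner_le_norm (𝕜 := ℂ) (x : H) x'
    rw [← h1, norm_pow, RCLike.norm_ofReal, abs_norm, sq] at h2
    rcases (norm_nonneg (x : H)).eq_or_lt with h0 | h0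
    · rw [← h0]
      exact norm_nonneg _
    · exact le_of_mul_le_mul_left h2 h0
  have hBk : (B ^ (k + 1)) (x : H) = (B ^ k * R) (T x - c • (x : H)) := by
    rw [pow_succ]
    change (B ^ k) (B x) = (B ^ k) (R _)
    rw [hR.resolvent_apply_shift c x]
  rw [inv_mul_le_iff₀ hM0]
  calc ‖(x : H)‖ ≤ K * ‖(B ^ (k + 1)) (x : H)‖ := hle.trans hxn
    _ ≤ K * (‖B ^ k * R‖ * ‖T x - c • (x : H)‖) := by
      rw [hBk]
      gcongr
      exact ContinuousLinearMap.le_opNorm _ _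
    _ ≤ M * ‖T x - c • (x : H)‖ := by
      rw [hM, mul_assoc]
      gcongr
      linarith

theorem derivedSet_spec_subset_ofReal (hT : IsSelfAdjoint T) {c : ℂ}
    (hc : c ∈ derivedSet (spec T)) : c.im = 0 := by
  by_contra h
  rw [mem_derivedSet, accPt_iff_frequently] at hc
  refine hc ?_
  filter_upwards [(isOpen_ne.preimage Complex.continuous_im).mem_nhds h] with z hz
  exact fun hz' => hz'.2 (mem_resolventSet_of_im_ne_zero hT hz)

theorem isBWeyl_shift_iff (hT : IsSelfAdjoint T) (c : ℂ) :
    IsBWeyl (shift T c) ↔ c ∉ derivedSet (spec T) := by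
  refine ⟨fun h hc => ?_, isBWeyl_shift_of_not_mem_derivedSet hT⟩
  obtain ⟨r, rfl⟩ : ∃ r : ℝ, (r : ℂ) = c :=
    ⟨c.re, Complex.ext rfl (derivedSet_spec_subset_ofReal hT hc).symm⟩
  obtain ⟨δ, hδ, hb⟩ := exists_bound_of_isBWeyl_shift hT h
  exact not_mem_derivedSet_of_bound hT hδ hb hc

theorem derivedSet_spec_subset (hT : IsSelfAdjoint T) : derivedSet (spec T) ⊆ spec T := by
  intro c hc hcr
  obtain ⟨r, rfl⟩ : ∃ r : ℝ, (r : ℂ) = c :=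
    ⟨c.re, Complex.ext rfl (derivedSet_spec_subset_ofReal hT hc).symm⟩
  obtain ⟨R, hR⟩ := mem_resolventSet_iff.1 hcr
  refine not_mem_derivedSet_of_bound hT (δ := (‖R‖ + 1)⁻¹) (by positivity) (fun x _ => ?_) hc
  rw [inv_mul_le_iff₀ (by positivity)]
  calc ‖(x : H)‖ = ‖R (T x - (r : ℂ) • (x : H))‖ := by rw [hR.left_inv]
    _ ≤ ‖R‖ * ‖T x - (r : ℂ) • (x : H)‖ := R.le_opNorm _
    _ ≤ _ := by gcongr; linarith

/-- The null-space component of `y` contributes nothing. The other component is a limit of vectors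
`(T - r) x`, and `⟪(T - r) x, u n⟫ = ⟪x, (T - r) (u n)⟫` tends to 0. -/
theorem tendsto_inner_zero_of_orthogonal_nullSpace (hT : IsSelfAdjoint T) {r : ℝ}
    {u : ℕ → T.domain} (hu : ∀ n, ‖(u n : H)‖ = 1) (huN : ∀ n, (u n : H) ∈ (nullSpace T r)ᗮ)
    (ht : Tendsto (fun n => ‖T (u n) - (r : ℂ) • (u n : H)‖) atTop (𝓝 0)) (y : H) :
    Tendsto (fun n => ⟪y, (u n : H)⟫) atTop (𝓝 0) := by
  have hclN : IsClosed (nullSpace T r : Set H) := by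
    rw [← orthogonal_ran_shift hT]
    exact Submodule.isClosed_orthogonal _
  have : CompleteSpace (nullSpace T r) := hclN.completeSpace_coe
  obtain ⟨p, hp, q, hq, rfl⟩ := (nullSpace T r).exists_add_mem_mem_orthogonal y
  rw [← orthogonal_ran_shift hT, Submodule.orthogonal_orthogonal_eq_closure] at hq
  rw [Metric.tendsto_atTop]
  intro ε hε
  obtain ⟨_, ⟨(x : T.domain), rfl⟩, hx⟩ := Metric.mem_closure_iff.1 hq (ε / 2) (by positivity)
  change dist q (T x - (r : ℂ) • (x : H)) < ε / 2 at hx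
  obtain ⟨N, hN⟩ := (Metric.tendsto_atTop.1 ht) (ε / 2 / (‖(x : H)‖ + 1)) (by positivity)
  refine ⟨N, fun n hn => ?_⟩
  have h1 := hN n hn
  rw [dist_zero_right, norm_norm, lt_div_iff₀ (by positivity)] at h1
  have h2 : ⟪p + q, (u n : H)⟫ = ⟪q - (T x - (r : ℂ) • (x : H)), (u n : H)⟫
      + ⟪(x : H), T (u n) - (r : ℂ) • (u n : H)⟫ := by
    rw [← inner_shift_eq hT, ← inner_add_left, sub_add_cancel, inner_add_left,
      Submodule.inner_right_of_mem_orthogonal hp (huN n), zero_add]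
  rw [dist_zero_right, h2]
  rw [dist_eq_norm] at hx
  have h3 := norm_inner_le_norm (𝕜 := ℂ) (q - (T x - (r : ℂ) • (x : H))) (u n : H)
  have h4 := norm_inner_le_norm (𝕜 := ℂ) (x : H) (T (u n) - (r : ℂ) • (u n : H))
  rw [hu, mul_one] at h3
  have h5 := norm_add_le ⟪q - (T x - (r : ℂ) • (x : H)), (u n : H)⟫
    ⟪(x : H), T (u n) - (r : ℂ) • (u n : H)⟫
  nlinarith [norm_nonneg (T (u n) - (r : ℂ) • (u n : H))]

/-- No lower bound can hold on the orthogonal complement of the null space; choosing the vectors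
there makes weak convergence automatic. -/
theorem exists_isWeylSeq (hT : IsSelfAdjoint T) {r : ℝ} (hr : (r : ℂ) ∈ derivedSet (spec T)) :
    ∃ u : ℕ → T.domain, IsWeylSeq T (r : ℂ) u := by
  have h : ∀ n : ℕ, ∃ u : T.domain, ‖(u : H)‖ = 1 ∧ (u : H) ∈ (nullSpace T r)ᗮ ∧
      ‖T u - (r : ℂ) • (u : H)‖ ≤ 1 / ((n : ℝ) + 1) := by
    intro n
    by_contra! hn
    refine not_mem_derivedSet_of_bound hT (δ := 1 / ((n : ℝ) + 1)) (by positivity)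
      (fun x hx => ?_) hr
    rcases (norm_nonneg (x : H)).eq_or_lt with h0 | h0
    · rw [← h0, mul_zero]
      exact norm_nonneg _
    have h1 := hn (((‖(x : H)‖⁻¹ : ℝ) : ℂ) • x) (by
      rw [Submodule.coe_smul, norm_smul, Complex.norm_real, norm_inv, norm_norm,
        inv_mul_cancel₀ h0.ne']) (Submodule.smul_mem _ _ hx)
    rw [T.map_smul, Submodule.coe_smul, smul_comm (r : ℂ), ← smul_sub, norm_smul,
      Complex.norm_real, norm_inv, norm_norm, lt_inv_mul_iff₀ h0] at h1
    rw [mul_comm]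
    exact h1.le
  choose u h1 h2 h3 using h
  have ht : Tendsto (fun n => ‖T (u n) - (r : ℂ) • (u n : H)‖) atTop (𝓝 0) :=
    squeeze_zero (fun _ => norm_nonneg _) h3 tendsto_one_div_add_atTop_nhds_zero_nat
  exact ⟨u, h1, tendsto_inner_zero_of_orthogonal_nullSpace hT h1 h2 ht, ht⟩

end SelfAdjoint

theorem mem_isoPts_iff {A : Set ℂ} {z : ℂ} : z ∈ isoPts A ↔ z ∈ A ∧ z ∉ derivedSet A := by
  rw [mem_derivedSet, accPt_iff_frequently, not_frequently]
  refine and_congr_right fun hz => ?_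
  constructor
  · rintro ⟨U, hU, h⟩
    filter_upwards [hU] with y hy hyA
    exact hyA.1 (h ▸ ⟨hy, hyA.2⟩ : y ∈ ({z} : Set ℂ))
  · intro h
    refine ⟨_, h, Set.eq_singleton_iff_unique_mem.2 ⟨⟨fun h' => h'.1 rfl, hz⟩, ?_⟩⟩
    rintro y ⟨hy, hyA⟩
    by_contra hne
    exact hy ⟨hne, hyA⟩

end UnbddOp

end

theorem mainTheorem7 {H : Type*} [NormedAddCommGroup H] [InnerProductSpace ℂ H] [CompleteSpace H]
    (T : H →ₗ.[ℂ] H) (hT : IsSelfAdjoint T) :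
    (∀ r : ℝ, (r : ℂ) ∈ UnbddOp.bWeylSpec T ↔
      (∃ u : ℕ → T.domain, UnbddOp.IsWeylSeq T (r : ℂ) u) ∧
        (r : ℂ) ∈ derivedSet (UnbddOp.spec T)) ∧
    UnbddOp.bDiscreteSpec T = UnbddOp.isoPts (UnbddOp.spec T) ∧
    UnbddOp.bWeylSpec T = derivedSet (UnbddOp.spec T) ∧
    UnbddOp.spec T = UnbddOp.bWeylSpec T ∪ UnbddOp.bDiscreteSpec T ∧
    Disjoint (UnbddOp.bWeylSpec T) (UnbddOp.bDiscreteSpec T) ∧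
    UnbddOp.spec T = derivedSet (UnbddOp.spec T) ∪ UnbddOp.isoPts (UnbddOp.spec T) ∧
    Disjoint (derivedSet (UnbddOp.spec T)) (UnbddOp.isoPts (UnbddOp.spec T)) := by
  have hW : UnbddOp.bWeylSpec T = derivedSet (UnbddOp.spec T) := by
    ext c
    exact (not_congr (UnbddOp.isBWeyl_shift_iff hT c)).trans not_not
  have hI : UnbddOp.isoPts (UnbddOp.spec T) =
      UnbddOp.spec T \ derivedSet (UnbddOp.spec T) := Set.ext fun _ => UnbddOp.mem_isoPts_iff
  have hD : UnbddOp.bDiscreteSpec T = UnbddOp.isoPts (UnbddOp.spec T) := by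
    rw [UnbddOp.bDiscreteSpec, hW, hI]
  have hU : UnbddOp.spec T = derivedSet (UnbddOp.spec T) ∪ UnbddOp.isoPts (UnbddOp.spec T) := by
    rw [hI, Set.union_sdiff_cancel (UnbddOp.derivedSet_spec_subset hT)]
  have hJ : Disjoint (derivedSet (UnbddOp.spec T)) (UnbddOp.isoPts (UnbddOp.spec T)) := by
    rw [hI]
    exact Set.disjoint_sdiff_right
  refine ⟨fun r => ?_, hD, hW, ?_, ?_, hU, hJ⟩
  · rw [hW]
    exact ⟨fun h => ⟨UnbddOp.exists_isWeylSeq hT h, h⟩, fun h => h.2⟩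
  · rw [hW, hD]
    exact hU
  · rw [hW, hD]
    exact hJ
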